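/- Let $E$ be a separable Banach space, $\mathcal K\subset E$ a nonempty compact set, $\mathbb Z_-=\{0,-1,-2,\dots\}$, and let $\boldsymbol{\mathcal K}=\mathcal K^{\mathbb Z_-}$ be endowed with the product topology and the distance $d(\boldsymbol\xi,\boldsymbol\xi')=\sum_{k\le 0}\iota^{k}\|\xi_k-\xi_k'\|_E$, where $\iota>1$ is fixed. Let $Q(\boldsymbol\xi;\cdot)$ be a transition probability from $\boldsymbol{\mathcal K}$ to $\mathcal K$. For $s\ge 0$ and $n\ge1$ let $Q_s^n(\boldsymbol\xi;\cdot)\in\mathcal P(\mathcal K^n)$ be the projection to the last $n$ components of the measure $$Q(\boldsymbol\xi;dy_1)\,Q((\boldsymbol\xi,y_1);dy_2)\cdots Q((\boldsymbol\xi,y_1,\dots,y_{s+n-1});dy_{s+n})$$ on $\mathcal K^{s+n}$, where $(\boldsymbol\xi,y_1,\dots,y_l)\in\boldsymbol{\mathcal K}$ denotes concatenation. Assume: * **(SF)** The map $\boldsymbol\xi\mapsto Q(\boldsymbol\xi;\cdot)$ is continuous from $\boldsymbol{\mathcal K}$ to $\mathcal P(\mathcal K)$ with the weak topology, and there is $C>0$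 such that $\|Q(\boldsymbol\xi;\cdot)-Q(\boldsymbol\xi';\cdot)\|_{\mathrm{var}}\le C\,d(\boldsymbol\xi,\boldsymbol\xi')$ for all $\boldsymbol\xi,\boldsymbol\xi'\in\boldsymbol{\mathcal K}$, where $\|\mu-\nu\|_{\mathrm{var}}=\sup_{A}|\mu(A)-\nu(A)|$ over Borel sets $A$. * **(DLP′)** There are an increasing sequence of finite-dimensional subspaces $F_n\subset E$ whose union is dense in $E$, and continuous projections $\mathsf P_n:E\to F_n$ with norms bounded uniformly in $n$, such that for every $n$ the following holds, where $F_n^\dagger=\ker\mathsf P_n$ and $\ell_n$ is a Lebesgue measure on $F_n$. There is a Lipschitz continuous function $\rho_n:\boldsymbol{\mathcal K}\times E\to\mathbb R_+$ such that, for every $\boldsymbol\xi\in\boldsymbol{\mathcal K}$, the measure $Q(\boldsymbol\xi;\cdot)$, regarded as a measure on $E=F_n\dotplus F_n^\dagger$, has the disintegration $$Q(\boldsymbol\xi;dy)=Q_n^\dagger(\boldsymbol\xi;dy_n^\dagger)\,\rho_n(\boldsymbol\xi,y_n^\dagger+y_n)\,\ell_n(dy_n),$$ where $y=y_n+y_n^\dagger$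 and $Q_n^\dagger(\boldsymbol\xi;\cdot)$ is the image of $Q(\boldsymbol\xi;\cdot)$ under $I-\mathsf P_n$. * **(SRZ)** For any $n\ge1$ and $\delta>0$ there is an integer $s\ge0$ such that $$\inf_{\boldsymbol\xi\in\boldsymbol{\mathcal K}}Q_s^n\bigl(\boldsymbol\xi;\{(y_1,\dots,y_n):\|y_i\|_E<\delta,\ 1\le i\le n\}\bigr)>0.$$ Then there is a $\mathcal K$-valued stationary random process $\{\eta_k\}_{k\in\mathbb Z}$ with the following property: if $\sigma$ denotes the law of $\{\eta_k\}_{k\in\mathbb Z_-}$ on $\boldsymbol{\mathcal K}$, then the conditional law of $\eta_1$ given the past $\{\eta_k\}_{k\in\mathbb Z_-}=\boldsymbol\xi$ has a version equal to $Q(\boldsymbol\xi;\cdot)$ for all $\boldsymbol\xi\in\operatorname{supp}\sigma$. Moreover, any two $\mathcal K$-valued stationary processes with this property have the same law on $\mathcal K^{\mathbb Z}$. -/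

import Mathlib

open MeasureTheory ProbabilityTheory

universe u v w

noncomputable section

namespace StationaryNoise

/-- The space of pasts `K ^ ℤ₋`. The set `ℤ₋ = {0, -1, -2, …}` is indexed by `ℕ` through `j ↦ -j`:
the entry `ξ j` is `ξ_{-j}`. It carries the product topology and the product `σ`-algebra. -/
abbrev Past {E : Type*} (K : Set E) : Type _ := ℕ → K

/-- The distance `d(ξ, ξ') = ∑_{k ≤ 0} ι ^ k ‖ξ_k - ξ'_k‖` on the space of pasts (`ι > 1`). -/
def pastDist {E : Type*} [NormedAddCommGroup E] {K : Set E} (ι : ℝ) (ξ ξ' : Past K) : ℝ :=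
  ∑' j : ℕ, (ι ^ j)⁻¹ * ‖(ξ j : E) - (ξ' j : E)‖

/-- The concatenation `(ξ, y)`: the new last (time `0`) entry is `y`, and the entries of `ξ` are
moved one step further into the past. -/
def concat {E : Type*} {K : Set E} (ξ : Past K) (y : K) : Past K
  | 0 => y
  | j + 1 => ξ j

/-- The total variation distance `sup_A |μ(A) - ν(A)|`, `A` ranging over the measurable sets. -/
def tvDist {α : Type*} [MeasurableSpace α] (μ ν : Measure α) : ℝ :=
  ⨆ A : {A : Set α // MeasurableSet A}, |μ.real A.1 - ν.real A.1|

theorem measurable_concat {E : Type*} [MeasurableSpace E] {K : Set E} :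
    Measurable (fun p : Past K × K => concat p.1 p.2) := by
  refine measurable_pi_iff.2 fun j => ?_
  cases j with
  | zero => exact measurable_snd
  | succ j => exact (measurable_pi_apply j).comp measurable_fst

/-- The law of `(η_1, …, η_k)` given the past `ξ`, that is
`Q(ξ; dy_1) Q((ξ, y_1); dy_2) ⋯ Q((ξ, y_1, …, y_{k-1}); dy_k)`, written recursively by splitting
off the first factor. -/
def jointLaw {E : Type*} [MeasurableSpace E] {K : Set E} (Q : Kernel (Past K) K) :
    (k : ℕ) → Kernel (Past K) (Fin k → K)
  | 0 => Kernel.const (Past K) (Measure.dirac Fin.elim0)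
  | k + 1 =>
    (Q ⊗ₖ (jointLaw Q k).comap (fun p : Past K × K => concat p.1 p.2) measurable_concat).map
      (fun p : K × (Fin k → K) => (Fin.cons p.1 p.2 : Fin (k + 1) → K))

instance isMarkovKernel_jointLaw {E : Type*} [MeasurableSpace E] {K : Set E}
    (Q : Kernel (Past K) K) [IsMarkovKernel Q] (k : ℕ) :
    IsMarkovKernel (jointLaw Q k) := by
  induction k with
  | zero => unfold jointLaw; infer_instance
  | succ k ih =>
    unfold jointLaw
    refine Kernel.IsMarkovKernel.map _ ?_
    refine measurable_pi_iff.2 fun i => ?_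
    refine Fin.cases ?_ (fun i => ?_) i
    · simpa using measurable_fst
    · exact (measurable_pi_apply i).comp measurable_snd

/-- The law of `(η_{s+1}, …, η_{s+n})` given the past `ξ`: the projection of the law of
`(η_1, …, η_{s+n})` to its last `n` components. -/
def delayedLaw {E : Type*} [MeasurableSpace E] {K : Set E}
    (Q : Kernel (Past K) K) (s n : ℕ) (ξ : Past K) : Measure (Fin n → K) :=
  (jointLaw Q (s + n) ξ).map (fun y i => y (Fin.natAdd s i))

/-- The transition probability `Q` as a map from pasts to the space of probability measures on `K`,
which carries the topology of weak convergence. -/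
def toProbabilityMeasure {E : Type*} [MeasurableSpace E] {K : Set E}
    (Q : Kernel (Past K) K) [IsMarkovKernel Q] (ξ : Past K) : ProbabilityMeasure K :=
  ⟨Q ξ, inferInstance⟩

/-- Strong Feller property of the noise: `ξ ↦ Q(ξ; ·)` is continuous for the weak topology on
probability measures, and Lipschitz in total variation. -/
def StrongFeller {E : Type*} [NormedAddCommGroup E] [MeasurableSpace E] [BorelSpace E]
    {K : Set E} (ι : ℝ) (Q : Kernel (Past K) K) [IsMarkovKernel Q] : Prop :=
  Continuous (toProbabilityMeasure Q) ∧
    ∃ C : ℝ, 0 < C ∧ ∀ ξ ξ' : Past K, tvDist (Q ξ) (Q ξ') ≤ C * pastDist ι ξ ξ'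

/-- Decomposability and Lipschitz property. There are finite-dimensional subspaces `F n`,
increasing, with dense union, and continuous projections `P n` onto `F n` with uniformly bounded
norms (the complementary subspace is the kernel of `P n`), such that the image of `Q(ξ; ·)` in `E`
disintegrates as `Q_n†(ξ; dz) ρ_n(ξ, z + y) ℓ_n(dy)`, where `Q_n†(ξ; ·)` is its image under
`I - P n`, the measure `ℓ n` is a Lebesgue (Haar) measure on `F n`, and `ρ n` is nonnegative and
Lipschitz on `Past K × E`. -/
def DecomposableLipschitz {E : Type*} [NormedAddCommGroup E] [NormedSpace ℝ E]
    [MeasurableSpace E] {K : Set E} (ι : ℝ) (Q : Kernel (Past K) K) : Prop :=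
  ∃ (F : ℕ → Submodule ℝ E) (P : ℕ → E →L[ℝ] E) (ℓ : (n : ℕ) → Measure (F n))
    (ρ : ℕ → Past K → E → ℝ),
    Monotone F ∧
    (∀ n, FiniteDimensional ℝ (F n)) ∧
    Dense (⋃ n, (F n : Set E)) ∧
    (∀ n, (∀ y, P n y ∈ F n) ∧ ∀ y ∈ F n, P n y = y) ∧
    (∃ B : ℝ, ∀ n, ‖P n‖ ≤ B) ∧
    (∀ n, (ℓ n).IsAddHaarMeasure) ∧
    (∀ n ξ y, 0 ≤ ρ n ξ y) ∧
    (∀ n, ∃ M : ℝ, ∀ (ξ ξ' : Past K) (y y' : E),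
      |ρ n ξ y - ρ n ξ' y'| ≤ M * (pastDist ι ξ ξ' + ‖y - y'‖)) ∧
    ∀ (n : ℕ) (ξ : Past K) (A : Set E), MeasurableSet A →
      ((Q ξ).map Subtype.val) A =
        ∫⁻ z, ((ℓ n).withDensity (fun y => ENNReal.ofReal (ρ n ξ (z + (y : E)))))
            {y | z + (y : E) ∈ A}
          ∂(((Q ξ).map Subtype.val).map (fun x => x - P n x))

/-- Strong recurrence to zero: for all `n ≥ 1` and `δ > 0` there is `s ≥ 0` such that, uniformly in
the past, `η_{s+1}, …, η_{s+n}` all lie in the open `δ`-ball around `0` with positive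
probability. -/
def StrongRecurrenceToZero {E : Type*} [NormedAddCommGroup E] [MeasurableSpace E] {K : Set E}
    (Q : Kernel (Past K) K) : Prop :=
  ∀ n : ℕ, 1 ≤ n → ∀ δ : ℝ, 0 < δ → ∃ s : ℕ,
    0 < ⨅ ξ : Past K, delayedLaw Q s n ξ {y | ∀ i, (y i : E) ∈ Metric.ball (0 : E) δ}

/-- The past `(η_k, k ≤ 0)` of a process indexed by `ℤ`. -/
def pastOf {E : Type*} {K : Set E} {Ω : Type*} (η : ℤ → Ω → K) (ω : Ω) : Past K :=
  fun j => η (-(j : ℤ)) ω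

/-- A process indexed by `ℤ` is stationary if all its time shifts have the same law. -/
structure IsStationary {E : Type*} [MeasurableSpace E] {K : Set E} {Ω : Type*}
    [MeasurableSpace Ω] (P₀ : Measure Ω) (η : ℤ → Ω → K) : Prop where
  measurable : ∀ k, Measurable (η k)
  shift_eq : ∀ m : ℤ, P₀.map (fun ω k => η (k + m) ω) = P₀.map (fun ω k => η k ω)

/-- With `σ` the law of the past `(η_k, k ≤ 0)`: the regular conditional law of `η_1` given the past
can be chosen (it is unique up to a `σ`-null set of pasts) to be equal to `Q(ξ; ·)` for every `ξ` in
the support of `σ`. -/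
def HasConditionalLaw {E : Type*} [TopologicalSpace E] [MeasurableSpace E] {K : Set E}
    {Ω : Type*} [MeasurableSpace Ω] (P₀ : Measure Ω) (η : ℤ → Ω → K)
    (Q : Kernel (Past K) K) : Prop :=
  ∃ Q' : Kernel (Past K) K, IsMarkovKernel Q' ∧
    P₀.map (fun ω => (pastOf η ω, η 1 ω)) = (P₀.map (pastOf η)) ⊗ₘ Q' ∧
    ∀ ξ ∈ (P₀.map (pastOf η)).support, Q' ξ = Q ξ

end StationaryNoise

end

/-! A stationary process whose conditional law is `Q` corresponds to an invariant law of the Markov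
chain of pasts, ξ ↦ (ξ, y) with y drawn from `Q ξ`. It thus suffices to show that this chain has
exactly one invariant law.

Let T be its transfer operator and f a Lipschitz function of the past. Appending a common entry
contracts the distance by ι⁻¹, while the total variation bound on `Q` controls the change of the
kernel by the oscillation of f. Hence the Lipschitz constants of all iterates of T on f share one
bound (`lipPast_iterate_transfer`). By strong recurrence, two independent copies of the chain,
started from arbitrary pasts, both end with a long block of small entries with probability at least
p². Their pasts are then close, so the values of any iterate at them are close too. The oscillation
of the iterates therefore tends to 0 (`exists_oscLE_iterate_transfer`).

Uniqueness follows because an invariant law integrates f and its iterates alike, and Lipschitz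
functions determine a law. Existence follows by compactness: a limit point of the laws of the chain
from a fixed past is invariant, since consecutive iterates at that past become equal in the limit.
The invariant law extends to two-sided sequences by a second compactness argument, and a two-sided
law is determined by the laws of its pasts. -/

namespace StationaryNoise

open Filter Topology

/-! ### Oscillation, total variation and integrals -/

section Oscillation

variable {α β : Type*} [MeasurableSpace α] [MeasurableSpace β]

/-- The oscillation of `f` is at most `o`. -/
def OscLE {α : Type*} (o : ℝ) (f : α → ℝ) : Prop := ∀ x y, f x - f y ≤ o

theorem OscLE.comp {α β : Type*} {o : ℝ} {f : α → ℝ} (h : OscLE o f) (g : β → α) :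
    OscLE o (fun x => f (g x)) := fun x y => h (g x) (g y)

theorem OscLE.integrable {o : ℝ} {f : α → ℝ} (h : OscLE o f) (hf : Measurable f) (μ : Measure α)
    [IsFiniteMeasure μ] : Integrable f μ := by
  rcases isEmpty_or_nonempty α with hα | ⟨⟨x₀⟩⟩
  · exact Integrable.of_isEmpty
  · refine Integrable.of_bound hf.aestronglyMeasurable (|f x₀| + o) (ae_of_all _ fun x => ?_)
    have h1 := h x x₀
    have h2 := h x₀ x
    rw [Real.norm_eq_abs, abs_le]
    have h3 := le_abs_self (f x₀)
    have h4 := neg_abs_le (f x₀)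
    constructor <;> linarith

theorem abs_measureReal_sub_le_tvDist (μ ν : Measure α) [IsProbabilityMeasure μ]
    [IsProbabilityMeasure ν] {A : Set α} (hA : MeasurableSet A) :
    |μ.real A - ν.real A| ≤ tvDist μ ν := by
  refine le_ciSup (f := fun A : {A : Set α // MeasurableSet A} => |μ.real A.1 - ν.real A.1|)
    ⟨1, ?_⟩ ⟨A, hA⟩
  rintro _ ⟨B, rfl⟩
  have h1 := measureReal_le_one (μ := μ) (s := B.1)
  have h2 := measureReal_le_one (μ := ν) (s := B.1)
  have h3 := measureReal_nonneg (μ := μ) (s := B.1)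
  have h4 := measureReal_nonneg (μ := ν) (s := B.1)
  simp only [abs_le]
  constructor <;> linarith

/-- Layer-cake formula: after subtracting its infimum, f takes values in [0, o], so each integral is
the integral over (0, o] of the masses of the superlevel sets, and these masses differ by at most
`tvDist μ ν`. -/
theorem integral_sub_le_mul_tvDist (μ ν : Measure α) [IsProbabilityMeasure μ]
    [IsProbabilityMeasure ν] {o : ℝ} {f : α → ℝ} (h : OscLE o f) (hf : Measurable f) :
    ∫ x, f x ∂μ - ∫ x, f x ∂ν ≤ o * tvDist μ ν := by
  obtain ⟨x₀⟩ : Nonempty α := nonempty_of_isProbabilityMeasure μ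
  have ho : 0 ≤ o := by simpa using h x₀ x₀
  have hbdd : BddBelow (Set.range f) := ⟨f x₀ - o, by rintro _ ⟨y, rfl⟩; linarith [h x₀ y]⟩
  set a := ⨅ x, f x with ha
  have hnn : ∀ x, 0 ≤ f x - a := fun x => sub_nonneg.2 (ciInf_le hbdd x)
  have hle : ∀ x, f x - a ≤ o := fun x => by
    have : Nonempty α := ⟨x₀⟩
    have : f x - o ≤ a := le_ciInf fun y => by linarith [h x y]
    linarith
  have key : ∀ (κ : Measure α) [IsProbabilityMeasure κ], ∫ x, f x ∂κ - a =
      ∫ t in Set.Ioc 0 o, κ.real {x | t ≤ f x - a} := by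
    intro κ _
    have hi := h.integrable hf κ
    have hi' : Integrable (fun x => f x - a) κ := hi.sub (integrable_const a)
    rw [← hi'.integral_eq_integral_Ioc_meas_le (ae_of_all _ hnn) (ae_of_all _ hle)]
    simp [integral_sub hi (integrable_const a)]
  have hint : ∀ (κ : Measure α) [IsProbabilityMeasure κ],
      IntegrableOn (fun t => κ.real {x | t ≤ f x - a}) (Set.Ioc 0 o) := by
    intro κ _
    have : Antitone fun t => κ.real {x | t ≤ f x - a} := fun s t hst =>
      measureReal_mono (fun x hx => le_trans hst hx)
    exact (intervalIntegrable_iff_integrableOn_Ioc_of_le ho).1 this.intervalIntegrable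
  have h1 : ∫ x, f x ∂μ - ∫ x, f x ∂ν =
      ∫ t in Set.Ioc 0 o, (μ.real {x | t ≤ f x - a} - ν.real {x | t ≤ f x - a}) := by
    rw [integral_sub (hint μ) (hint ν), ← key μ, ← key ν]
    ring
  rw [h1]
  calc _ ≤ ∫ t in Set.Ioc 0 o, tvDist μ ν := by
        refine setIntegral_mono_on ((hint μ).sub (hint ν)) (by simp) measurableSet_Ioc fun t _ => ?_
        exact (le_abs_self _).trans (abs_measureReal_sub_le_tvDist μ ν
          (measurableSet_le measurable_const (hf.sub_const a)))
    _ = o * tvDist μ ν := by simp [ho]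

/-- Comparison of two integrals by an independent coupling. -/
theorem integral_sub_integral_le (μ : Measure α) (ν : Measure β) [IsProbabilityMeasure μ]
    [IsProbabilityMeasure ν] {F : α → ℝ} {G : β → ℝ} (hF : Integrable F μ) (hG : Integrable G ν)
    {o e p : ℝ} {A : Set α} {B : Set β} (hA : MeasurableSet A) (hB : MeasurableSet B)
    (h : ∀ x y, F x - G y ≤ o) (hAB : ∀ x ∈ A, ∀ y ∈ B, F x - G y ≤ e) (heo : e ≤ o) (hp : 0 ≤ p)
    (hpA : p ≤ μ.real A) (hpB : p ≤ ν.real B) :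
    ∫ x, F x ∂μ - ∫ y, G y ∂ν ≤ o - (o - e) * p ^ 2 := by
  have hF' : Integrable (fun z : α × β => F z.1) (μ.prod ν) := hF.comp_fst ν
  have hG' : Integrable (fun z : α × β => G z.2) (μ.prod ν) := hG.comp_snd μ
  have h1 : ∫ x, F x ∂μ - ∫ y, G y ∂ν = ∫ z : α × β, (F z.1 - G z.2) ∂(μ.prod ν) := by
    rw [integral_sub hF' hG', integral_fun_fst, integral_fun_snd]
    simp
  have hi : Integrable ((A ×ˢ B).indicator fun _ : α × β => o - e) (μ.prod ν) :=
    (integrable_const _).indicator (hA.prod hB)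
  have h2 : ∫ z : α × β, (F z.1 - G z.2) ∂(μ.prod ν) ≤
      ∫ z, (o - (A ×ˢ B).indicator (fun _ : α × β => o - e) z) ∂(μ.prod ν) := by
    refine integral_mono (hF'.sub hG') ((integrable_const _).sub hi) fun z => ?_
    by_cases hz : z ∈ A ×ˢ B
    · simp only [Set.indicator_of_mem hz]
      linarith [hAB z.1 hz.1 z.2 hz.2]
    · simp only [Set.indicator_of_notMem hz]
      linarith [h z.1 z.2]
  have h3 : ∫ z, (o - (A ×ˢ B).indicator (fun _ : α × β => o - e) z) ∂(μ.prod ν) =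
      o - (o - e) * (μ.real A * ν.real B) := by
    rw [integral_sub (integrable_const _) hi, integral_indicator (hA.prod hB)]
    simp [measureReal_prod_prod, mul_comm]
  have h4 : p ^ 2 ≤ μ.real A * ν.real B := by
    rw [pow_two]; exact mul_le_mul hpA hpB hp (hp.trans hpA)
  have h5 := mul_le_mul_of_nonneg_left h4 (sub_nonneg.2 heo)
  linarith

end Oscillation

/-! ### The distance on pasts -/

section PastDist

variable {E : Type*} [NormedAddCommGroup E] {K : Set E} {ι : ℝ}

theorem summable_inv_pow (hι : 1 < ι) : Summable fun j : ℕ => (ι ^ j)⁻¹ := by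
  simpa using summable_geometric_of_lt_one (inv_nonneg.2 (by linarith)) (inv_lt_one_of_one_lt₀ hι)

theorem exists_norm_sub_le (hK : IsCompact K) : ∃ D : ℝ, 0 < D ∧ ∀ x y : K, ‖(x : E) - y‖ ≤ D := by
  obtain ⟨D, hD, h⟩ := hK.isBounded.exists_pos_norm_le
  refine ⟨D + D, by linarith, fun x y => (norm_sub_le _ _).trans ?_⟩
  exact add_le_add (h x x.2) (h y y.2)

theorem summable_pastDist (hK : IsCompact K) (hι : 1 < ι) (ξ ξ' : Past K) :
    Summable fun j : ℕ => (ι ^ j)⁻¹ * ‖(ξ j : E) - (ξ' j : E)‖ := by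
  obtain ⟨D, -, h⟩ := exists_norm_sub_le hK
  have hι0 : 0 < ι := by linarith
  refine Summable.of_nonneg_of_le (fun j => by positivity) (fun j => ?_)
    ((summable_inv_pow hι).mul_right D)
  exact mul_le_mul_of_nonneg_left (h _ _) (by positivity)

theorem pastDist_nonneg (hι : 1 < ι) (ξ ξ' : Past K) : 0 ≤ pastDist ι ξ ξ' :=
  tsum_nonneg fun j => mul_nonneg (inv_nonneg.2 (pow_nonneg (by linarith) _)) (norm_nonneg _)

theorem pastDist_comm (ξ ξ' : Past K) : pastDist ι ξ ξ' = pastDist ι ξ' ξ := by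
  simp only [pastDist, norm_sub_rev]

theorem pastDist_self (ξ : Past K) : pastDist ι ξ ξ = 0 := by simp [pastDist]

/-- The common new entry contributes nothing, and every older entry moves one step back, losing a
factor ι in its weight. This is the source of the contraction. -/
theorem pastDist_concat (hK : IsCompact K) (hι : 1 < ι) (ξ ξ' : Past K) (y : K) :
    pastDist ι (concat ξ y) (concat ξ' y) = ι⁻¹ * pastDist ι ξ ξ' := by
  rw [pastDist, (summable_pastDist hK hι _ _).tsum_eq_zero_add, pastDist, ← tsum_mul_left]
  simp only [concat, sub_self, norm_zero, mul_zero, zero_add, pow_succ, mul_inv]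
  exact tsum_congr fun j => by ring

theorem norm_apply_sub_le (hK : IsCompact K) (hι : 1 < ι) (ξ ξ' : Past K) (j : ℕ) :
    ‖(ξ j : E) - ξ' j‖ ≤ ι ^ j * pastDist ι ξ ξ' := by
  have hι0 : 0 < ι := by linarith
  have := (summable_pastDist hK hι ξ ξ').le_tsum j (fun i _ => by positivity)
  rw [inv_mul_eq_div, div_le_iff₀ (by positivity)] at this
  rw [mul_comm]
  exact this

theorem continuous_pastDist (hK : IsCompact K) (hι : 1 < ι) (ξ' : Past K) :
    Continuous fun ξ : Past K => pastDist ι ξ ξ' := by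
  obtain ⟨D, -, h⟩ := exists_norm_sub_le hK
  have hι0 : 0 < ι := by linarith
  refine continuous_tsum (fun j => by fun_prop) ((summable_inv_pow hι).mul_right D) fun j ξ => ?_
  rw [Real.norm_of_nonneg (by positivity)]
  exact mul_le_mul_of_nonneg_left (h _ _) (by positivity)

/-- Entries beyond the first n contribute at most a geometric tail, as K is bounded; the first n
contribute at most ε / 2 once δ is of order ε / n. -/
theorem exists_pastDist_lt (hK : IsCompact K) (hι : 1 < ι) {ε : ℝ} (hε : 0 < ε) :
    ∃ n : ℕ, 1 ≤ n ∧ ∃ δ : ℝ, 0 < δ ∧ ∀ ξ ξ' : Past K, (∀ j < n, ‖(ξ j : E)‖ < δ) →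
      (∀ j < n, ‖(ξ' j : E)‖ < δ) → pastDist ι ξ ξ' < ε := by
  obtain ⟨D, hD, h⟩ := exists_norm_sub_le hK
  have hι0 : 0 < ι := by linarith
  have hs := (summable_inv_pow hι).mul_right D
  have ht := (tendsto_sum_nat_add fun j : ℕ => (ι ^ j)⁻¹ * D).eventually (gt_mem_nhds (half_pos hε))
  obtain ⟨n, hn1, hn⟩ := ((eventually_ge_atTop 1).and ht).exists
  have hn0 : (0 : ℝ) < n := by exact_mod_cast hn1
  refine ⟨n, hn1, ε / 2 / n / 2, by positivity, fun ξ ξ' h1 h2 => ?_⟩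
  rw [pastDist, ← (summable_pastDist hK hι ξ ξ').sum_add_tsum_nat_add n]
  have hA : ∑ j ∈ Finset.range n, (ι ^ j)⁻¹ * ‖(ξ j : E) - ξ' j‖ ≤ ε / 2 := by
    calc _ ≤ ∑ j ∈ Finset.range n, ε / 2 / n := by
          refine Finset.sum_le_sum fun j hj => ?_
          have hj := Finset.mem_range.1 hj
          have h3 : (ι ^ j)⁻¹ ≤ 1 := inv_le_one_of_one_le₀ (one_le_pow₀ hι.le)
          have h4 : ‖(ξ j : E) - ξ' j‖ ≤ ε / 2 / n :=
            (norm_sub_le _ _).trans (by linarith [h1 j hj, h2 j hj])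
          calc _ ≤ 1 * (ε / 2 / n) := mul_le_mul h3 h4 (norm_nonneg _) zero_le_one
            _ = _ := one_mul _
      _ = ε / 2 := by
          rw [Finset.sum_const, Finset.card_range, nsmul_eq_mul]
          field_simp
  have hB : ∑' j, (ι ^ (j + n))⁻¹ * ‖(ξ (j + n) : E) - ξ' (j + n)‖ ≤
      ∑' j : ℕ, (ι ^ (j + n))⁻¹ * D :=
    ((summable_nat_add_iff n).2 (summable_pastDist hK hι ξ ξ')).tsum_le_tsum
      (fun j => mul_le_mul_of_nonneg_left (h _ _) (by positivity)) ((summable_nat_add_iff n).2 hs)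
  linarith

/-- `f` is Lipschitz with constant `L` for the distance `pastDist ι`. -/
def LipPast (ι L : ℝ) (f : Past K → ℝ) : Prop := ∀ ξ ξ', f ξ - f ξ' ≤ L * pastDist ι ξ ξ'

theorem LipPast.continuous (hK : IsCompact K) (hι : 1 < ι) {L : ℝ} {f : Past K → ℝ}
    (h : LipPast ι L f) : Continuous f := by
  refine continuous_iff_continuousAt.2 fun ξ₀ => ?_
  refine tendsto_iff_dist_tendsto_zero.2 ?_
  have h0 : Tendsto (fun ξ => L * pastDist ι ξ ξ₀) (𝓝 ξ₀) (𝓝 0) := by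
    have := ((continuous_pastDist hK hι ξ₀).const_mul L).tendsto ξ₀
    simpa [pastDist_self] using this
  refine squeeze_zero (fun _ => dist_nonneg) (fun ξ => ?_) h0
  rw [Real.dist_eq, abs_le]
  have h1 := h ξ ξ₀
  have h2 := h ξ₀ ξ
  rw [pastDist_comm] at h2
  constructor <;> linarith

end PastDist

/-! ### Measures determined by their marginals -/

section Marginals

/-- Two finite measures on a product space with the same finite-dimensional marginals agree. -/
theorem ext_of_map_restrict {I : Type*} {X : Type*} [MeasurableSpace X] {μ ν : Measure (I → X)}
    [IsFiniteMeasure μ] (h : ∀ J : Finset I, μ.map J.restrict = ν.map J.restrict) : μ = ν := by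
  have : ∀ J : Finset I, IsFiniteMeasure (μ.map (J.restrict (π := fun _ => X))) := fun J =>
    inferInstance
  exact IsProjectiveLimit.unique (P := fun J => μ.map J.restrict) (fun _ => rfl)
    fun J => (h J).symm

/-- The past, seen from time `m`, of a sequence indexed by `ℤ`. -/
def pastAt {X : Type*} (m : ℤ) (x : ℤ → X) : ℕ → X := fun j => x (m - j)

theorem measurable_pastAt {X : Type*} [MeasurableSpace X] (m : ℤ) :
    Measurable (pastAt m : (ℤ → X) → ℕ → X) :=
  measurable_pi_iff.2 fun _ => measurable_pi_apply _

/-- A finite set of times has an upper bound m, and its coordinates are a function of the past seen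
from m. -/
theorem ext_of_map_pastAt {X : Type*} [MeasurableSpace X] {μ ν : Measure (ℤ → X)}
    [IsFiniteMeasure μ] (h : ∀ m : ℤ, μ.map (pastAt m) = ν.map (pastAt m)) : μ = ν := by
  refine ext_of_map_restrict fun J => ?_
  obtain ⟨m, hm⟩ := J.bddAbove
  let g : (ℕ → X) → J → X := fun ξ i => ξ (m - i).toNat
  have hg : Measurable g := measurable_pi_iff.2 fun _ => measurable_pi_apply _
  have hJ : (J.restrict : (ℤ → X) → J → X) = g ∘ pastAt m := by
    funext x i
    have : (i : ℤ) ≤ m := hm i.2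
    simp only [Finset.restrict, Function.comp, g, pastAt]
    congr 1
    omega
  rw [hJ, ← Measure.map_map hg (measurable_pastAt m), h m, Measure.map_map hg (measurable_pastAt m)]

variable {E : Type*} [NormedAddCommGroup E] [SecondCountableTopology E] [MeasurableSpace E]
  [BorelSpace E] {K : Set E} {ι : ℝ}

/-- Probability measures on the space of pasts are determined by the integrals of Lipschitz
functions. -/
theorem ext_of_integral_lipPast (hK : IsCompact K) (hι : 1 < ι) {μ ν : Measure (Past K)}
    [IsProbabilityMeasure μ] [IsProbabilityMeasure ν]
    (h : ∀ (f : Past K → ℝ) (o L : ℝ), 0 ≤ L → Measurable f → OscLE o f → LipPast ι L f →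
      ∫ ξ, f ξ ∂μ = ∫ ξ, f ξ ∂ν) : μ = ν := by
  refine ext_of_map_restrict fun J => ?_
  have hres : Measurable (J.restrict : Past K → J → K) := Finset.measurable_restrict J
  have hμ : IsProbabilityMeasure (μ.map (J.restrict : Past K → J → K)) :=
    Measure.isProbabilityMeasure_map hres.aemeasurable
  have hν : IsProbabilityMeasure (ν.map (J.restrict : Past K → J → K)) :=
    Measure.isProbabilityMeasure_map hres.aemeasurable
  let μ' : ProbabilityMeasure (J → K) := ⟨_, hμ⟩
  let ν' : ProbabilityMeasure (J → K) := ⟨_, hν⟩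
  -- Weak convergence can be tested on bounded Lipschitz functions, so equal integrals make the
  -- constant sequence μ' converge to ν'; uniqueness of limits then gives μ' = ν'.
  have ht : Tendsto (fun _ : ℕ => μ') atTop (𝓝 ν') := by
    refine tendsto_iff_forall_lipschitz_integral_tendsto.2 fun f ⟨o, ho⟩ ⟨L, hL⟩ => ?_
    have hfm : Measurable f := hL.continuous.measurable
    have : ∫ x, f x ∂(μ' : Measure (J → K)) = ∫ x, f x ∂(ν' : Measure (J → K)) := by
      change ∫ x, f x ∂(μ.map J.restrict) = ∫ x, f x ∂(ν.map J.restrict)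
      rw [integral_map hres.aemeasurable hfm.aestronglyMeasurable,
        integral_map hres.aemeasurable hfm.aestronglyMeasurable]
      obtain ⟨N, hN⟩ := J.bddAbove
      have hι0 : 0 < ι := by linarith
      -- Entry j has weight ι⁻ʲ in the distance, so restricting to indices at most N costs a factor
      -- ι ^ N.
      refine h _ o (L * ι ^ N) (by positivity) (hfm.comp hres)
        (fun x y => (le_abs_self _).trans (ho _ _)) fun ξ ξ' => ?_
      have h1 := hL.dist_le_mul (J.restrict ξ) (J.restrict ξ')
      have h2 : dist (J.restrict ξ) (J.restrict ξ') ≤ ι ^ N * pastDist ι ξ ξ' := by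
        refine (dist_pi_le_iff (mul_nonneg (by positivity) (pastDist_nonneg hι _ _))).2
          fun i => ?_
        rw [Subtype.dist_eq, dist_eq_norm]
        refine (norm_apply_sub_le hK hι ξ ξ' i).trans ?_
        exact mul_le_mul_of_nonneg_right (pow_le_pow_right₀ hι.le (hN i.2))
          (pastDist_nonneg hι _ _)
      rw [mul_assoc]
      exact (le_abs_self _).trans (h1.trans (mul_le_mul_of_nonneg_left h2 L.coe_nonneg))
    rw [this]
    exact tendsto_const_nhds
  have := tendsto_nhds_unique tendsto_const_nhds ht
  exact congrArg Subtype.val this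

end Marginals

/-! ### The transfer operator of the chain of pasts -/

section Transfer

variable {E : Type*} {K : Set E}

/-- The concatenation of a past with a finite block, written in chronological order. -/
def concatBlock {k : ℕ} (ξ : Past K) (y : Fin k → K) : Past K := fun j =>
  if h : j < k then y ⟨k - 1 - j, by omega⟩ else ξ (j - k)

/-- The oldest entry of the block can be absorbed into the past, which matches the recursion of
`jointLaw`. -/
theorem concatBlock_cons {k : ℕ} (ξ : Past K) (y₀ : K) (y : Fin k → K) :
    concatBlock ξ (Fin.cons y₀ y : Fin (k + 1) → K) = concatBlock (concat ξ y₀) y := by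
  funext j
  rcases lt_trichotomy j k with h | h | h
  · have h1 : (⟨k + 1 - 1 - j, by omega⟩ : Fin (k + 1)) = Fin.succ ⟨k - 1 - j, by omega⟩ := by
      ext; simp; omega
    simp only [concatBlock, h, dif_pos, show j < k + 1 by omega]
    rw [h1, Fin.cons_succ]
  · subst h
    have h1 : (⟨j + 1 - 1 - j, by omega⟩ : Fin (j + 1)) = 0 := by ext; simp
    simp only [concatBlock, lt_irrefl, dif_neg, not_false_eq_true, show j < j + 1 by omega, dif_pos]
    rw [h1, Fin.cons_zero]
    simp [concat]
  · obtain ⟨i, rfl⟩ := Nat.exists_eq_add_of_lt h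
    simp only [concatBlock, show ¬ k + i + 1 < k by omega, show ¬ k + i + 1 < k + 1 by omega,
      dif_neg, not_false_eq_true]
    rw [show k + i + 1 - k = i + 1 by omega, show k + i + 1 - (k + 1) = i by omega]
    rfl

variable [MeasurableSpace E]

/-- The operator `f ↦ ∫ f (ξ, y) Q(ξ; dy)`. -/
noncomputable def transfer (Q : Kernel (Past K) K) (f : Past K → ℝ) (ξ : Past K) : ℝ :=
  ∫ y, f (concat ξ y) ∂Q ξ

theorem measurable_concat_right (ξ : Past K) : Measurable (concat ξ) :=
  measurable_concat.comp measurable_prodMk_left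

theorem measurable_concatBlock (k : ℕ) :
    Measurable fun p : Past K × (Fin k → K) => concatBlock p.1 p.2 := by
  refine measurable_pi_iff.2 fun j => ?_
  by_cases h : j < k
  · simp only [concatBlock, h, dif_pos]
    exact (measurable_pi_apply _).comp measurable_snd
  · simp only [concatBlock, h, dif_neg, not_false_eq_true]
    exact (measurable_pi_apply _).comp measurable_fst

theorem measurable_concatBlock_right {k : ℕ} (ξ : Past K) :
    Measurable (concatBlock ξ : (Fin k → K) → Past K) :=
  (measurable_concatBlock k).comp measurable_prodMk_left

theorem measurable_finCons (k : ℕ) :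
    Measurable fun p : K × (Fin k → K) => (Fin.cons p.1 p.2 : Fin (k + 1) → K) := by
  refine measurable_pi_iff.2 fun i => ?_
  refine Fin.cases ?_ (fun i => ?_) i
  · simpa using measurable_fst
  · exact (measurable_pi_apply i).comp measurable_snd

variable {Q : Kernel (Past K) K} [IsMarkovKernel Q] {f : Past K → ℝ} {o : ℝ}

theorem measurable_transfer (hf : Measurable f) : Measurable (transfer Q f) :=
  ((hf.comp measurable_concat).stronglyMeasurable.integral_kernel_prod_right' (κ := Q)).measurable

theorem oscLE_transfer (hf : Measurable f) (h : OscLE o f) : OscLE o (transfer Q f) := by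
  intro ξ ξ'
  -- With p = 0 and e = o the coupling lemma gives no gain, only the trivial bound o.
  have := integral_sub_integral_le (Q ξ) (Q ξ')
    ((h.comp (concat ξ)).integrable (hf.comp (measurable_concat_right ξ)) _)
    ((h.comp (concat ξ')).integrable (hf.comp (measurable_concat_right ξ')) _)
    MeasurableSet.univ MeasurableSet.univ (fun x y => h _ _) (fun x _ y _ => h _ _) le_rfl
    (p := 0) le_rfl (by simp) (by simp)
  simpa [transfer] using this

theorem measurable_iterate_transfer (hf : Measurable f) (k : ℕ) :
    Measurable ((transfer Q)^[k] f) := by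
  induction k with
  | zero => exact hf
  | succ k ih => rw [Function.iterate_succ_apply']; exact measurable_transfer ih

theorem oscLE_iterate_transfer (hf : Measurable f) (h : OscLE o f) (k : ℕ) :
    OscLE o ((transfer Q)^[k] f) := by
  induction k with
  | zero => exact h
  | succ k ih =>
    rw [Function.iterate_succ_apply']
    exact oscLE_transfer (measurable_iterate_transfer hf k) ih

theorem iterate_transfer_eq_integral (hf : Measurable f) (h : OscLE o f) (k : ℕ) (ξ : Past K) :
    (transfer Q)^[k] f ξ = ∫ y, f (concatBlock ξ y) ∂jointLaw Q k ξ := by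
  induction k generalizing ξ with
  | zero =>
    have : ∀ y : Fin 0 → K, concatBlock ξ y = ξ := fun y => by funext j; simp [concatBlock]
    simp [this]
  | succ k ih =>
    have hm : Measurable fun y : Fin (k + 1) → K => f (concatBlock ξ y) :=
      hf.comp (measurable_concatBlock_right ξ)
    rw [Function.iterate_succ_apply', transfer, jointLaw, Kernel.map_apply _ (measurable_finCons k),
      integral_map (measurable_finCons k).aemeasurable hm.aestronglyMeasurable, integral_compProd]
    · simp only [concatBlock_cons, Kernel.comap_apply]
      exact integral_congr_ae (ae_of_all _ fun y => ih _)
    · exact OscLE.integrable (h.comp _)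
        (hf.comp ((measurable_concatBlock_right ξ).comp (measurable_finCons k))) _

end Transfer

/-! ### Contraction of the oscillation -/

section Contraction

variable {E : Type*} [NormedAddCommGroup E] [MeasurableSpace E] {K : Set E} {ι : ℝ}
  {Q : Kernel (Past K) K} [IsMarkovKernel Q] {f : Past K → ℝ} {o L C : ℝ}

/-- Change the kernel first, at cost o times the total variation distance, and then the past inside
f, at cost L times the contracted distance. -/
theorem lipPast_transfer (hK : IsCompact K) (hι : 1 < ι) (ho : 0 ≤ o)
    (hC : ∀ ξ ξ' : Past K, tvDist (Q ξ) (Q ξ') ≤ C * pastDist ι ξ ξ')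
    (hf : Measurable f) (h : OscLE o f) (hL : LipPast ι L f) :
    LipPast ι (ι⁻¹ * L + C * o) (transfer Q f) := by
  intro ξ ξ'
  have hm : ∀ ζ : Past K, Measurable fun y => f (concat ζ y) := fun ζ =>
    hf.comp (measurable_concat_right ζ)
  have hi : ∀ ζ : Past K, Integrable (fun y => f (concat ζ y)) (Q ξ') := fun ζ =>
    (h.comp (concat ζ)).integrable (hm ζ) _
  have h1 : ∫ y, f (concat ξ y) ∂Q ξ - ∫ y, f (concat ξ y) ∂Q ξ' ≤ o * (C * pastDist ι ξ ξ') :=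
    (integral_sub_le_mul_tvDist _ _ (h.comp (concat ξ)) (hm ξ)).trans
      (mul_le_mul_of_nonneg_left (hC _ _) ho)
  have h2 : ∫ y, f (concat ξ y) ∂Q ξ' - ∫ y, f (concat ξ' y) ∂Q ξ' ≤
      L * (ι⁻¹ * pastDist ι ξ ξ') := by
    rw [← integral_sub (hi ξ) (hi ξ')]
    calc _ ≤ ∫ _, L * (ι⁻¹ * pastDist ι ξ ξ') ∂Q ξ' := by
          refine integral_mono ((hi ξ).sub (hi ξ')) (integrable_const _) fun y => ?_
          exact (hL _ _).trans_eq (by rw [pastDist_concat hK hι])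
      _ = _ := by simp
  unfold transfer
  calc _ ≤ o * (C * pastDist ι ξ ξ') + L * (ι⁻¹ * pastDist ι ξ ξ') := by linarith
    _ = _ := by ring

/-- The term C * o / (1 - ι⁻¹) is the fixed point of x ↦ ι⁻¹ * x + C * o, so the bound survives each
step and is uniform in k. -/
theorem lipPast_iterate_transfer (hK : IsCompact K) (hι : 1 < ι) (ho : 0 ≤ o) (hC0 : 0 ≤ C)
    (hC : ∀ ξ ξ' : Past K, tvDist (Q ξ) (Q ξ') ≤ C * pastDist ι ξ ξ')
    (hf : Measurable f) (h : OscLE o f) (hL0 : 0 ≤ L) (hL : LipPast ι L f) (k : ℕ) :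
    LipPast ι (L + C * o / (1 - ι⁻¹)) ((transfer Q)^[k] f) := by
  have hι1 : 0 < 1 - ι⁻¹ := sub_pos.2 (inv_lt_one_of_one_lt₀ hι)
  induction k with
  | zero =>
    intro ξ ξ'
    refine (hL ξ ξ').trans (mul_le_mul_of_nonneg_right ?_ (pastDist_nonneg hι _ _))
    have : 0 ≤ C * o / (1 - ι⁻¹) := by positivity
    linarith
  | succ k ih =>
    rw [Function.iterate_succ_apply']
    intro ξ ξ'
    refine (lipPast_transfer hK hι ho hC (measurable_iterate_transfer hf k)
      (oscLE_iterate_transfer hf h k) ih ξ ξ').trans ?_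
    refine mul_le_mul_of_nonneg_right ?_ (pastDist_nonneg hι _ _)
    have hι0 : 0 ≤ ι⁻¹ := inv_nonneg.2 (by linarith)
    have hM : ι⁻¹ * L ≤ L := by
      nlinarith
    have h2 := div_mul_cancel₀ (C * o) hι1.ne'
    linarith

variable [BorelSpace E]

/-- Positive lower bound for the probability that the last `n` entries are small. -/
theorem exists_le_measureReal_jointLaw (hSRZ : StrongRecurrenceToZero Q) {n : ℕ} (hn : 1 ≤ n)
    {δ : ℝ} (hδ : 0 < δ) : ∃ (k : ℕ) (p : ℝ), 0 < p ∧ ∀ ξ : Past K,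
      p ≤ (jointLaw Q k ξ).real {y | ∀ j < n, ‖(concatBlock ξ y j : E)‖ < δ} := by
  obtain ⟨s, hs⟩ := hSRZ n hn δ hδ
  set m := ⨅ ξ : Past K, delayedLaw Q s n ξ {y | ∀ i, (y i : E) ∈ Metric.ball (0 : E) δ} with hm
  -- Over an empty index set the infimum would be ⊤, with real part 0.
  rcases isEmpty_or_nonempty (Past K) with hE | ⟨⟨ξ₀⟩⟩
  · exact ⟨0, 1, one_pos, fun ξ => (hE.false ξ).elim⟩
  have hmeas : Measurable fun (y : Fin (s + n) → K) (i : Fin n) => y (Fin.natAdd s i) :=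
    measurable_pi_iff.2 fun _ => measurable_pi_apply _
  have hset : MeasurableSet {y : Fin n → K | ∀ i, (y i : E) ∈ Metric.ball (0 : E) δ} := by
    rw [Set.ofPred_forall]
    exact MeasurableSet.iInter fun i => (measurable_subtype_coe.comp (measurable_pi_apply i))
      Metric.isOpen_ball.measurableSet
  have hle : ∀ ξ, m ≤ jointLaw Q (s + n) ξ {y | ∀ j < n, ‖(concatBlock ξ y j : E)‖ < δ} := by
    intro ξ
    refine (iInf_le _ ξ).trans ?_
    rw [delayedLaw, Measure.map_apply hmeas hset]
    -- Pasts are indexed backwards: entry j of the new past is entry n - 1 - j of the final block.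
    refine measure_mono fun y hy j hj => ?_
    have := hy ⟨n - 1 - j, by omega⟩
    simp only [mem_ball_zero_iff] at this
    have hidx : (⟨s + n - 1 - j, by omega⟩ : Fin (s + n)) = Fin.natAdd s ⟨n - 1 - j, by omega⟩ := by
      ext
      simp
      omega
    rwa [concatBlock, dif_pos (by omega), hidx]
  have hfin : m ≠ ⊤ := ((hle ξ₀).trans_lt (measure_lt_top _ _)).ne
  exact ⟨s + n, m.toReal, ENNReal.toReal_pos hs.ne' hfin, fun ξ =>
    ENNReal.toReal_mono (measure_ne_top _ _) (hle ξ)⟩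

/-- The oscillation of the iterates of the transfer operator tends to zero. -/
theorem exists_oscLE_iterate_transfer (hK : IsCompact K) (hK0 : K.Nonempty) (hι : 1 < ι)
    (hC0 : 0 ≤ C) (hC : ∀ ξ ξ' : Past K, tvDist (Q ξ) (Q ξ') ≤ C * pastDist ι ξ ξ')
    (hSRZ : StrongRecurrenceToZero Q) (hf : Measurable f) (h : OscLE o f) (hL0 : 0 ≤ L)
    (hL : LipPast ι L f) {ε : ℝ} (hε : 0 < ε) : ∃ k : ℕ, OscLE ε ((transfer Q)^[k] f) := by
  obtain ⟨x₀, hx₀⟩ := hK0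
  let ξ₀ : Past K := fun _ => ⟨x₀, hx₀⟩
  have hnn : ∀ {g : Past K → ℝ} {r : ℝ}, OscLE r g → 0 ≤ r := fun hg => by
    simpa using hg ξ₀ ξ₀
  have ho := hnn h
  have hι1 : 0 < 1 - ι⁻¹ := sub_pos.2 (inv_lt_one_of_one_lt₀ hι)
  set M := L + C * o / (1 - ι⁻¹) with hM
  have hM0 : 0 ≤ M := by positivity
  have hlip := lipPast_iterate_transfer hK hι ho hC0 hC hf h hL0 hL
  let S : Set ℝ := {r | ∃ k, OscLE r ((transfer Q)^[k] f)}
  have hS : S.Nonempty := ⟨o, 0, h⟩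
  have hSb : BddBelow S := ⟨0, by rintro r ⟨k, hk⟩; exact hnn hk⟩
  -- If the infimum q of all oscillation bounds were positive, the coupling would improve every
  -- bound by a fixed amount, contradicting minimality.
  set q := sInf S with hq
  suffices hq0 : q < ε by
    obtain ⟨r, ⟨k, hk⟩, hr⟩ := exists_lt_of_csInf_lt hS hq0
    exact ⟨k, fun x y => (hk x y).trans hr.le⟩
  by_contra! hqε
  have hqpos : 0 < q := hε.trans_le hqε
  -- Pasts this close have values within q / 2 under every iterate; M + 1 avoids dividing by zero.
  obtain ⟨n, hn, δ, hδ, hsmall⟩ := exists_pastDist_lt (K := K) hK hι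
    (ε := q / 2 / (M + 1)) (by positivity)
  obtain ⟨m, p, hp, hpm⟩ := exists_le_measureReal_jointLaw hSRZ hn hδ
  have hstep : ∀ r ∈ S, q ≤ r - (r - q / 2) * p ^ 2 := by
    rintro r ⟨k, hk⟩
    have hr : q ≤ r := csInf_le hSb ⟨k, hk⟩
    refine csInf_le hSb ⟨m + k, fun ξ ξ' => ?_⟩
    have hg := measurable_iterate_transfer (Q := Q) hf k
    rw [Function.iterate_add_apply, iterate_transfer_eq_integral hg hk,
      iterate_transfer_eq_integral hg hk]
    have hset : ∀ ζ : Past K,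
        MeasurableSet {y : Fin m → K | ∀ j < n, ‖(concatBlock ζ y j : E)‖ < δ} := by
      intro ζ
      have : {y : Fin m → K | ∀ j < n, ‖(concatBlock ζ y j : E)‖ < δ} =
          ⋂ j, ⋂ _ : j < n, {y | ‖(concatBlock ζ y j : E)‖ < δ} := by ext; simp
      rw [this]
      refine MeasurableSet.iInter fun j => MeasurableSet.iInter fun _ => ?_
      exact measurableSet_lt (measurable_norm.comp (measurable_subtype_coe.comp
        ((measurable_pi_apply j).comp (measurable_concatBlock_right ζ)))) measurable_const
    refine integral_sub_integral_le _ _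
      ((hk.comp _).integrable (hg.comp (measurable_concatBlock_right ξ)) _)
      ((hk.comp _).integrable (hg.comp (measurable_concatBlock_right ξ')) _)
      (hset ξ) (hset ξ') (fun _ _ => hk _ _) (fun y hy y' hy' => ?_) (by linarith) hp.le
      (hpm ξ) (hpm ξ')
    refine (hlip k _ _).trans ?_
    calc _ ≤ (M + 1) * (q / 2 / (M + 1)) :=
          mul_le_mul (by linarith) (hsmall _ _ hy hy').le (pastDist_nonneg hι _ _) (by linarith)
      _ = q / 2 := by field_simp
  have hp1 : p ^ 2 ≤ 1 := by
    have := (hpm ξ₀).trans measureReal_le_one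
    exact pow_le_one₀ hp.le this
  -- Since r ≥ q, the gain (r - q / 2) * p ^ 2 is at least q / 2 * p ^ 2, whatever r is.
  have : q + q / 2 * p ^ 2 ≤ q := by
    refine le_csInf hS fun r hr => ?_
    have h1 := hstep r hr
    have h2 : q ≤ r := csInf_le hSb hr
    nlinarith [pow_pos hp 2]
  nlinarith [pow_pos hp 2]

end Contraction

/-! ### Invariant laws of the chain of pasts -/

section Invariant

variable {E : Type*} [MeasurableSpace E] {K : Set E}

/-- `σ` is invariant for the chain of pasts driven by `Q`. -/
def IsInvariantLaw (Q : Kernel (Past K) K) (σ : Measure (Past K)) : Prop :=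
  (σ ⊗ₘ Q).map (fun p => concat p.1 p.2) = σ

/-- Forgetting the last entry of a past. -/
def dropLast {X : Type*} (ξ : ℕ → X) : ℕ → X := fun j => ξ (j + 1)

theorem measurable_dropLast {X : Type*} [MeasurableSpace X] :
    Measurable (dropLast : (ℕ → X) → ℕ → X) :=
  measurable_pi_iff.2 fun _ => measurable_pi_apply _

/-- Splitting off the last entry inverts `concat`, so under an invariant law the last entry has
conditional law `Q` given the earlier ones. -/
theorem IsInvariantLaw.map_dropLast_prodMk {Q : Kernel (Past K) K} {σ : Measure (Past K)}
    (hσ : IsInvariantLaw Q σ) :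
    σ.map (fun ξ => (dropLast ξ, ξ 0)) = σ ⊗ₘ Q := by
  conv_lhs => rw [← hσ]
  rw [Measure.map_map (measurable_dropLast.prodMk (measurable_pi_apply 0)) measurable_concat]
  exact Measure.map_id

variable {Q : Kernel (Past K) K} [IsMarkovKernel Q] {σ : Measure (Past K)} [IsProbabilityMeasure σ]

theorem integral_map_concat_compProd {f : Past K → ℝ} {o : ℝ} (hf : Measurable f) (h : OscLE o f) :
    ∫ ξ, f ξ ∂((σ ⊗ₘ Q).map (fun p => concat p.1 p.2)) = ∫ ξ, transfer Q f ξ ∂σ := by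
  rw [integral_map measurable_concat.aemeasurable hf.aestronglyMeasurable,
    Measure.integral_compProd ((h.comp _).integrable (hf.comp measurable_concat) _)]
  rfl

theorem IsInvariantLaw.integral_iterate_transfer (hσ : IsInvariantLaw Q σ) {f : Past K → ℝ} {o : ℝ}
    (hf : Measurable f) (h : OscLE o f) (k : ℕ) :
    ∫ ξ, (transfer Q)^[k] f ξ ∂σ = ∫ ξ, f ξ ∂σ := by
  induction k with
  | zero => rfl
  | succ k ih =>
    simp only [Function.iterate_succ_apply']
    rw [← integral_map_concat_compProd (measurable_iterate_transfer hf k)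
      (oscLE_iterate_transfer hf h k), hσ, ih]

theorem IsInvariantLaw.map_dropLast (hσ : IsInvariantLaw Q σ) : σ.map dropLast = σ := by
  conv_lhs => rw [← hσ]
  rw [Measure.map_map measurable_dropLast measurable_concat]
  exact Measure.fst_compProd σ Q

theorem IsInvariantLaw.map_shift (hσ : IsInvariantLaw Q σ) (k : ℕ) :
    σ.map (fun ξ j => ξ (j + k)) = σ := by
  induction k with
  | zero => exact Measure.map_id
  | succ k ih =>
    conv_rhs => rw [← ih, ← hσ.map_dropLast]
    rw [Measure.map_map (measurable_pi_iff.2 fun _ => measurable_pi_apply _) measurable_dropLast]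
    rfl

end Invariant

/-! ### Uniqueness, existence and two-sided extension of the invariant law. -/

section InvariantUnique

variable {E : Type*} [NormedAddCommGroup E] [SecondCountableTopology E] [MeasurableSpace E]
  [BorelSpace E] {K : Set E} {ι : ℝ} {Q : Kernel (Past K) K} [IsMarkovKernel Q]

/-- The chain of pasts has at most one invariant law. -/
theorem IsInvariantLaw.unique (hK : IsCompact K) (hK0 : K.Nonempty) (hι : 1 < ι)
    (hSF : StrongFeller ι Q) (hSRZ : StrongRecurrenceToZero Q) {σ σ' : Measure (Past K)}
    [IsProbabilityMeasure σ] [IsProbabilityMeasure σ'] (hσ : IsInvariantLaw Q σ)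
    (hσ' : IsInvariantLaw Q σ') : σ = σ' := by
  obtain ⟨-, C, hC0, hC⟩ := hSF
  have key : ∀ {σ σ' : Measure (Past K)} [IsProbabilityMeasure σ] [IsProbabilityMeasure σ'],
      IsInvariantLaw Q σ → IsInvariantLaw Q σ' → ∀ (f : Past K → ℝ) (o L : ℝ), 0 ≤ L →
      Measurable f → OscLE o f → LipPast ι L f → ∫ ξ, f ξ ∂σ ≤ ∫ ξ, f ξ ∂σ' := by
    intro σ σ' _ _ hσ hσ' f o L hL0 hf h hL
    refine le_of_forall_pos_le_add fun ε hε => ?_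
    obtain ⟨k, hk⟩ := exists_oscLE_iterate_transfer hK hK0 hι hC0.le hC hSRZ hf h hL0 hL hε
    have hg := measurable_iterate_transfer (Q := Q) hf k
    have := integral_sub_integral_le σ σ' (hk.integrable hg σ) (hk.integrable hg σ')
      MeasurableSet.univ MeasurableSet.univ (fun x y => hk x y) (fun x _ y _ => hk x y) le_rfl
      (p := 0) le_rfl (by simp) (by simp)
    rw [hσ.integral_iterate_transfer hf h, hσ'.integral_iterate_transfer hf h] at this
    linarith
  exact ext_of_integral_lipPast hK hι fun f o L hL0 hf h hL =>
    le_antisymm (key hσ hσ' f o L hL0 hf h hL) (key hσ' hσ f o L hL0 hf h hL)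

/-- The chain of pasts has an invariant law. -/
theorem exists_isInvariantLaw (hK : IsCompact K) (hK0 : K.Nonempty) (hι : 1 < ι)
    (hSF : StrongFeller ι Q) (hSRZ : StrongRecurrenceToZero Q) :
    ∃ σ : Measure (Past K), IsProbabilityMeasure σ ∧ IsInvariantLaw Q σ := by
  obtain ⟨-, C, hC0, hC⟩ := hSF
  have : CompactSpace K := isCompact_iff_compactSpace.1 hK
  obtain ⟨x₀, hx₀⟩ := hK0
  let ξ₀ : Past K := fun _ => ⟨x₀, hx₀⟩
  let μ : ℕ → ProbabilityMeasure (Past K) := fun k =>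
    ⟨(jointLaw Q k ξ₀).map (concatBlock ξ₀),
      Measure.isProbabilityMeasure_map (measurable_concatBlock_right ξ₀).aemeasurable⟩
  have hμ : ∀ {f : Past K → ℝ} {o : ℝ}, Measurable f → OscLE o f → ∀ k,
      ∫ ξ, f ξ ∂(μ k : Measure (Past K)) = (transfer Q)^[k] f ξ₀ := by
    intro f o hf h k
    rw [iterate_transfer_eq_integral hf h]
    exact integral_map (measurable_concatBlock_right ξ₀).aemeasurable hf.aestronglyMeasurable
  -- Probability measures on the compact space of pasts form a compact space, so the laws at time k
  -- converge along an ultrafilter; no time averaging is needed.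
  let U : Ultrafilter (ProbabilityMeasure (Past K)) := (hyperfilter ℕ).map μ
  set σ := U.lim with hσdef
  have hlim : Tendsto μ (hyperfilter ℕ) (𝓝 σ) := U.le_nhds_lim
  refine ⟨σ, inferInstance, ?_⟩
  have htend : ∀ {f : Past K → ℝ} {o L : ℝ}, Measurable f → OscLE o f → LipPast ι L f →
      Tendsto (fun k => (transfer Q)^[k] f ξ₀) (hyperfilter ℕ)
        (𝓝 (∫ ξ, f ξ ∂(σ : Measure (Past K)))) := by
    intro f o L hf h hL
    have := ProbabilityMeasure.tendsto_iff_forall_integral_tendsto.1 hlim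
      (BoundedContinuousFunction.mkOfCompact ⟨f, hL.continuous hK hι⟩)
    exact this.congr fun k => hμ hf h k
  have hprob : IsProbabilityMeasure
      (((σ : Measure (Past K)) ⊗ₘ Q).map (fun p => concat p.1 p.2)) :=
    Measure.isProbabilityMeasure_map measurable_concat.aemeasurable
  refine ext_of_integral_lipPast hK hι fun f o L hL0 hf h hL => ?_
  have ho : 0 ≤ o := by simpa using h ξ₀ ξ₀
  rw [integral_map_concat_compProd hf h]
  have h1 := htend (measurable_transfer hf) (oscLE_transfer hf h)
    (lipPast_transfer hK hι ho hC hf h hL)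
  have h2 := htend hf h hL
  have h3 : Tendsto (fun k => (transfer Q)^[k] (transfer Q f) ξ₀ - (transfer Q)^[k] f ξ₀)
      (hyperfilter ℕ) (𝓝 0) := by
    refine Tendsto.mono_left ?_ (hyperfilter_le_cofinite.trans_eq Nat.cofinite_eq_atTop)
    rw [Metric.tendsto_atTop]
    intro ε hε
    obtain ⟨N, hN⟩ := exists_oscLE_iterate_transfer hK ⟨x₀, hx₀⟩ hι hC0.le hC hSRZ hf h hL0 hL
      (half_pos hε)
    refine ⟨N, fun k hk => ?_⟩
    obtain ⟨i, rfl⟩ := Nat.exists_eq_add_of_le' hk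
    have hosc : OscLE (ε / 2) ((transfer Q)^[i + N] f) := by
      rw [Function.iterate_add_apply]
      exact oscLE_iterate_transfer (measurable_iterate_transfer hf N) hN i
    have hg := measurable_iterate_transfer (Q := Q) hf (i + N)
    rw [← Function.iterate_succ_apply, Function.iterate_succ_apply', Real.dist_eq, sub_zero]
    -- One more step averages values of g, all within ε / 2 of g ξ₀.
    set g := (transfer Q)^[i + N] f
    have hi := (hosc.comp (concat ξ₀)).integrable (hg.comp (measurable_concat_right ξ₀)) (Q ξ₀)
    have hup : transfer Q g ξ₀ ≤ g ξ₀ + ε / 2 := by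
      have := integral_mono hi (integrable_const (g ξ₀ + ε / 2)) fun y => by
        linarith [hosc (concat ξ₀ y) ξ₀]
      simpa [transfer] using this
    have hlo : g ξ₀ - ε / 2 ≤ transfer Q g ξ₀ := by
      have := integral_mono (integrable_const (g ξ₀ - ε / 2)) hi fun y => by
        linarith [hosc ξ₀ (concat ξ₀ y)]
      simpa [transfer] using this
    rw [abs_lt]
    constructor <;> linarith
  exact sub_eq_zero.1 (tendsto_nhds_unique (h1.sub h2) h3)

/-- An invariant law of the chain of pasts extends to a law on two-sided sequences all of whose
pasts have this law. -/
theorem IsInvariantLaw.exists_map_pastAt_eq (hK : IsCompact K) {σ : Measure (Past K)}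
    [IsProbabilityMeasure σ] (hσ : IsInvariantLaw Q σ) :
    ∃ ν : Measure (ℤ → K), IsProbabilityMeasure ν ∧ ∀ m : ℤ, ν.map (pastAt m) = σ := by
  have : CompactSpace K := isCompact_iff_compactSpace.1 hK
  -- The past is placed so that it ends at time k; later times all repeat its last entry. Once k ≥
  -- m, the past seen from m is a shift of ξ and so has law σ.
  let R : ℕ → Past K → ℤ → K := fun k ξ i => ξ (k - i).toNat
  have hR : ∀ k, Measurable (R k) := fun k => measurable_pi_iff.2 fun _ => measurable_pi_apply _
  let μ : ℕ → ProbabilityMeasure (ℤ → K) := fun k =>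
    ⟨σ.map (R k), Measure.isProbabilityMeasure_map (hR k).aemeasurable⟩
  let U : Ultrafilter (ProbabilityMeasure (ℤ → K)) := (hyperfilter ℕ).map μ
  have hlim : Tendsto μ (hyperfilter ℕ) (𝓝 U.lim) := U.le_nhds_lim
  refine ⟨U.lim, inferInstance, fun m => ?_⟩
  have hc : Continuous (pastAt m : (ℤ → K) → Past K) := continuous_pi fun _ => continuous_apply _
  have h1 := ProbabilityMeasure.tendsto_map_of_tendsto_of_continuous μ U.lim hlim hc
  let σ' : ProbabilityMeasure (Past K) := ⟨σ, inferInstance⟩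
  have h2 : Tendsto (fun k => (μ k).map hc.measurable.aemeasurable) (hyperfilter ℕ) (𝓝 σ') := by
    refine Tendsto.mono_left ?_ (hyperfilter_le_cofinite.trans_eq Nat.cofinite_eq_atTop)
    refine tendsto_const_nhds.congr' ?_
    filter_upwards [eventually_ge_atTop m.toNat] with k hk
    refine Subtype.ext ?_
    change σ = (σ.map (R k)).map (pastAt m)
    rw [Measure.map_map (measurable_pastAt m) (hR k)]
    conv_lhs => rw [← hσ.map_shift (k - m).toNat]
    congr 1
    funext ξ j
    simp only [Function.comp, pastAt, R]
    congr 1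
    omega
  have h3 : (U.lim.map hc.measurable.aemeasurable) = σ' := tendsto_nhds_unique h1 h2
  exact congrArg Subtype.val h3

end InvariantUnique

/-! ### Stationary processes -/

section StationaryProcesses

variable {E : Type*} [MeasurableSpace E] {K : Set E} {Ω : Type*} [MeasurableSpace Ω]
  {P₀ : Measure Ω} {η : ℤ → Ω → K}

theorem IsStationary.map_pastAt (hη : IsStationary P₀ η) (m : ℤ) :
    (P₀.map fun ω k => η k ω).map (pastAt m) = P₀.map (pastOf η) := by
  have hm : ∀ m : ℤ, Measurable fun ω k => η (k + m) ω := fun m =>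
    measurable_pi_iff.2 fun _ => hη.measurable _
  rw [← hη.shift_eq (-m), Measure.map_map (measurable_pastAt m) (hm _)]
  congr 1
  funext ω j
  simp only [Function.comp, pastAt, pastOf]
  congr 1
  omega

/-- The coordinate process under a law all of whose pasts have the same invariant law. -/
theorem isStationary_coordinates {ν : Measure (ℤ → K)} [IsProbabilityMeasure ν]
    {σ : Measure (Past K)} (hν : ∀ m : ℤ, ν.map (pastAt m) = σ) :
    IsStationary ν fun k x => x k := by
  refine ⟨fun k => measurable_pi_apply k, fun m => ?_⟩
  have hm : Measurable fun (x : ℤ → K) k => x (k + m) :=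
    measurable_pi_iff.2 fun _ => measurable_pi_apply _
  refine ext_of_map_pastAt fun i => ?_
  rw [Measure.map_map (measurable_pastAt i) hm, show (fun (x : ℤ → K) k => x k) = id from rfl,
    Measure.map_id, hν i, ← hν (i + m)]
  congr 1
  funext x j
  simp only [Function.comp, pastAt]
  congr 1
  omega

theorem hasConditionalLaw_coordinates [TopologicalSpace E] {Q : Kernel (Past K) K}
    [IsMarkovKernel Q] {ν : Measure (ℤ → K)}
    {σ : Measure (Past K)} [IsProbabilityMeasure σ] (hσ : IsInvariantLaw Q σ)
    (hν : ∀ m : ℤ, ν.map (pastAt m) = σ) :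
    HasConditionalLaw ν (fun k x => x k) Q := by
  refine ⟨Q, inferInstance, ?_, fun _ _ => rfl⟩
  have h0 : (pastOf fun (k : ℤ) (x : ℤ → K) => x k) = pastAt 0 := by
    funext x j
    simp [pastOf, pastAt]
  rw [h0, hν 0, ← hσ.map_dropLast_prodMk, ← hν 1,
    Measure.map_map (measurable_dropLast.prodMk (measurable_pi_apply 0)) (measurable_pastAt 1)]
  congr 1
  funext x
  refine Prod.ext ?_ (by simp [pastAt])
  funext j
  simp only [Function.comp, pastAt, dropLast]
  congr 1
  push_cast
  omega

/-- The law of the past of a stationary process with conditional law `Q` is invariant. -/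
theorem IsStationary.isInvariantLaw [TopologicalSpace E] [SecondCountableTopology E]
    {Q : Kernel (Past K) K} [IsMarkovKernel Q] [IsProbabilityMeasure P₀] (hη : IsStationary P₀ η)
    (hQ : HasConditionalLaw P₀ η Q) : IsInvariantLaw Q (P₀.map (pastOf η)) := by
  obtain ⟨Q', hQ', hjoint, heq⟩ := hQ
  have hpast : Measurable (pastOf η) := measurable_pi_iff.2 fun _ => hη.measurable _
  have hmeas : Measurable fun ω k => η k ω := measurable_pi_iff.2 fun _ => hη.measurable _
  have : IsProbabilityMeasure (P₀.map (pastOf η)) :=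
    Measure.isProbabilityMeasure_map hpast.aemeasurable
  -- The support has full measure by second countability, so agreement there is agreement almost
  -- everywhere.
  have hae : Q' =ᵐ[P₀.map (pastOf η)] Q := by
    filter_upwards [Measure.support_mem_ae] with ξ hξ using heq ξ hξ
  rw [IsInvariantLaw, ← Measure.compProd_congr hae, ← hjoint,
    Measure.map_map measurable_concat (hpast.prodMk (hη.measurable 1)), ← hη.map_pastAt 1,
    Measure.map_map (measurable_pastAt 1) hmeas]
  congr 1
  funext ω j
  cases j with
  | zero => simp [concat, pastAt]
  | succ j =>
    simp only [Function.comp, concat, pastAt, pastOf]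
    congr 1
    push_cast
    omega

end StationaryProcesses

end StationaryNoise

/-! ### From the invariant law to the stationary process. -/

theorem corollary4p3
    {E : Type u} [NormedAddCommGroup E] [NormedSpace ℝ E] [CompleteSpace E]
    [SecondCountableTopology E] [MeasurableSpace E] [BorelSpace E]
    (K : Set E) (hK : IsCompact K) (hK0 : K.Nonempty)
    (ι : ℝ) (hι : 1 < ι)
    (Q : Kernel (StationaryNoise.Past K) K) [IsMarkovKernel Q]
    (hSF : StationaryNoise.StrongFeller ι Q)
    (hDLP : StationaryNoise.DecomposableLipschitz ι Q)
    (hSRZ : StationaryNoise.StrongRecurrenceToZero Q) :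
    (∃ (Ω : Type u) (_ : MeasurableSpace Ω) (P₀ : Measure Ω) (_ : IsProbabilityMeasure P₀)
        (η : ℤ → Ω → K),
      StationaryNoise.IsStationary P₀ η ∧ StationaryNoise.HasConditionalLaw P₀ η Q) ∧
    (∀ (Ω : Type v) (_ : MeasurableSpace Ω) (P₀ : Measure Ω) (_ : IsProbabilityMeasure P₀)
        (η : ℤ → Ω → K)
        (Ω' : Type w) (_ : MeasurableSpace Ω') (P₀' : Measure Ω') (_ : IsProbabilityMeasure P₀')
        (η' : ℤ → Ω' → K),
      StationaryNoise.IsStationary P₀ η → StationaryNoise.HasConditionalLaw P₀ η Q →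
      StationaryNoise.IsStationary P₀' η' → StationaryNoise.HasConditionalLaw P₀' η' Q →
      P₀.map (fun ω k => η k ω) = P₀'.map (fun ω k => η' k ω)) := by
  obtain ⟨σ, hσp, hσ⟩ := StationaryNoise.exists_isInvariantLaw hK hK0 hι hSF hSRZ
  obtain ⟨ν, hνp, hν⟩ := hσ.exists_map_pastAt_eq hK
  refine ⟨⟨ℤ → K, inferInstance, ν, hνp, fun k x => x k,
    StationaryNoise.isStationary_coordinates hν,
    StationaryNoise.hasConditionalLaw_coordinates hσ hν⟩, ?_⟩
  intro Ω _ P₀ _ η Ω' _ P₀' _ η' hη hQ hη' hQ'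
  have hm : Measurable fun ω k => η k ω := measurable_pi_iff.2 fun k => hη.measurable k
  have := Measure.isProbabilityMeasure_map (μ := P₀) hm.aemeasurable
  have hp : Measurable (StationaryNoise.pastOf η) :=
    measurable_pi_iff.2 fun _ => hη.measurable _
  have hp' : Measurable (StationaryNoise.pastOf η') :=
    measurable_pi_iff.2 fun _ => hη'.measurable _
  have := Measure.isProbabilityMeasure_map (μ := P₀) hp.aemeasurable
  have := Measure.isProbabilityMeasure_map (μ := P₀') hp'.aemeasurable
  refine StationaryNoise.ext_of_map_pastAt fun m => ?_
  rw [hη.map_pastAt, hη'.map_pastAt]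
  exact (hη.isInvariantLaw hQ).unique hK hK0 hι hSF hSRZ (hη'.isInvariantLaw hQ')
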